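/- \textbf{Theorem (Soundness and completeness for server-testing).} Let $\mathrm{Act}$ be an infinite set of actions with an involution $a\mapsto\overline a$ (complementation), let $\tau,\checkmark\notin \mathrm{Act}$ be distinct, and let $\mu$ range over $\mathrm{Act}\cup\{\tau\}$. CCS terms are given by $p ::= 1 \mid A \mid \mu.p \mid \sum_{i\in I}p_i$, with $I$ countable and each constant $A$ having a definition $A:=p_A$; $0$ is the empty sum, $p+q$ the binary sum, and $\tau^\infty$ is a constant with definition $\tau^\infty:=\tau.\tau^\infty$. The transitions are the least ones with $1\xrightarrow{\checkmark}0$, $\mu.p\xrightarrow{\mu}p$, $\sum_i p_i\xrightarrow{\lambda}p'$ if $p_i\xrightarrow{\lambda}p'$ for some $i$, and $A\xrightarrow{\lambda}p'$ if $p_A\xrightarrow{\lambda}p'$. For a server $p$ and a client $r$, the composition $p\parallel r$ makes a $\tau$-move whenever $p$ or $r$ does, or when $p$ performs some $a\in\mathrm{Act}$ and $r$ performs $\overline a$. A computation from $p\parallel r$ is a sequence of $\tau$-moves; it is maximal if it is infinite or ends in a state without $\tau$-moves. Write $p\ \mathrm{must}\ r$ if every maximal computation from $p\parallel r$ contains a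 state $p_k\parallel r_k$ with $r_k\xrightarrow{\checkmark}$. Let $p\sqsubseteq_{svr}q$ mean that $p\ \mathrm{must}\ r$ implies $q\ \mathrm{must}\ r$ for every CCS term $r$. Finite CCS consists of the finite terms built from $0$, $1$, $+$, $\mu.\_$ and $\tau^\infty$; let $\sqsubseteq^c_{svr}$ be the largest precongruence on finite CCS (a preorder preserved by all these operators) that is contained in $\sqsubseteq_{svr}$. Let $x,y,z$ range over finite CCS terms, and $\mathring{x}$ over finite CCS terms with $\mathring{x}\not\xrightarrow{\checkmark}$. Let SVR consist of the equations saying that $(+,0)$ is an idempotent commutative monoid, together with \begin{align*} \text{(S1a)}&\ \ \mu.\mathring{x}+\mu.y=\mu.(\tau.\mathring{x}+\tau.y) & \text{(S1b)}&\ \ \tau.x\le\tau.\tau.x\\ \text{(S2)}&\ \ \mathring{x}+\tau.y=\tau.(\mathring{x}+y)+\tau.y & \text{(S3)}&\ \ \mu.x+\tau.(\mu.y+z)=\tau.(\mu.x+\mu.y+z)\\ \text{(S4)}&\ \ \tau.x+\tau.y\le x & \text{(S5)}&\ \ \tau^\infty\le x\\ \text{(SVR1)}&\ \ 1=0. \end{align*}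 Then, for all finite CCS terms $p$ and $q$, $p\sqsubseteq^c_{svr}q$ if and only if the inequation $p\le q$ is derivable from SVR by inequational reasoning, that is, lies in the least precongruence on finite CCS containing all instances of SVR, each equation being read as two inequations. -/

import Mathlib

universe u v

namespace ServerTesting

/-- The set of actions extended with the internal action `τ`; elements are written `μ`. -/
inductive ActTau (Act : Type u) : Type u
  | act (a : Act)
  | tau

/-- Transition labels: the visible actions, `τ`, and the success label `✓`; elements are
written `lam`. -/
inductive Label (Act : Type u) : Type u
  | ofActTau (μ : ActTau Act)
  | ok

namespace Label

/-- The label of a visible action. -/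
abbrev act {Act : Type u} (a : Act) : Label Act := ofActTau (ActTau.act a)

/-- The label of the internal action. -/
abbrev tau {Act : Type u} : Label Act := ofActTau ActTau.tau

end Label

/-! ### Testing in a labelled transition system -/

section Testing

variable {Act : Type u} {P : Type v}

/-- Transitions of the composition `p ∥ r` of two states of an LTS with transition relation
`Tr`, where `co` is the complementation of actions. -/
inductive Par (co : Act → Act) (Tr : P → Label Act → P → Prop) :
    P × P → Label Act → P × P → Prop
  | left {q q' : P} {lam : Label Act} (p : P) (h : Tr q lam q') : Par co Tr (q, p) lam (q', p)
  | right {p p' : P} {lam : Label Act} (q : P) (h : Tr p lam p') : Par co Tr (q, p) lam (q, p')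
  | synch {q q' p p' : P} {a : Act} (hq : Tr q (Label.act a) q')
      (hp : Tr p (Label.act (co a)) p') : Par co Tr (q, p) Label.tau (q', p')

/-- `c` is a maximal computation from `p ∥ r` with `N ∈ ℕ ∪ {∞}` steps: a sequence
`c 0, c 1, …` of internal moves which is infinite, or which ends in a state without internal
moves. If `N` is finite, the values `c i` with `i > N` are irrelevant. -/
structure IsMaxComputation (co : Act → Act) (Tr : P → Label Act → P → Prop) (p r : P)
    (N : ℕ∞) (c : ℕ → P × P) : Prop where
  start : c 0 = (p, r)
  step : ∀ i : ℕ, (i : ℕ∞) < N → Par co Tr (c i) Label.tau (c (i + 1))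
  maximal : ∀ n : ℕ, N = (n : ℕ∞) → ¬ ∃ s, Par co Tr (c n) Label.tau s

/-- The server `p` satisfies the client `r`: on every maximal computation from `p ∥ r`, the
client component reaches a state that can report success. -/
def Must (co : Act → Act) (Tr : P → Label Act → P → Prop) (p r : P) : Prop :=
  ∀ (N : ℕ∞) (c : ℕ → P × P), IsMaxComputation co Tr p r N c →
    ∃ k : ℕ, (k : ℕ∞) ≤ N ∧ ∃ r', Tr (c k).2 Label.ok r'

/-- The server testing preorder. -/
def ServerLE (co : Act → Act) (Tr : P → Label Act → P → Prop) (p₁ p₂ : P) : Prop :=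
  ∀ r : P, Must co Tr p₁ r → Must co Tr p₂ r

end Testing

/-! ### Infinitary CCS -/

/-- Terms of infinitary CCS with definitional constants from `K`. The countable index sets of
sums are represented by the subsets of `ℕ`. -/
inductive CCS (Act : Type u) (K : Type v) : Type (max u v)
  | one : CCS Act K
  | const (A : K) : CCS Act K
  | pre (μ : ActTau Act) (p : CCS Act K) : CCS Act K
  | sum (I : Set ℕ) (p : I → CCS Act K) : CCS Act K

namespace CCS

variable {Act : Type u} {K : Type v}

/-- The empty sum `0`. -/
def nil : CCS Act K := sum ∅ (fun i => absurd i.2 (Set.notMem_empty i.1))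

/-- The binary sum `p + q`, a sum over the index set `{0, 1}`. -/
def add (p q : CCS Act K) : CCS Act K := sum {0, 1} (fun i => if i.1 = 0 then p else q)

/-- The operational semantics of CCS, where the constant `A` is defined to be `D A`. -/
inductive Step (D : K → CCS Act K) : CCS Act K → Label Act → CCS Act K → Prop
  | ok : Step D one Label.ok nil
  | pre (μ : ActTau Act) (p : CCS Act K) : Step D (pre μ p) (Label.ofActTau μ) p
  | sum {I : Set ℕ} {p : I → CCS Act K} {lam : Label Act} {p' : CCS Act K} (i : I)
      (h : Step D (p i) lam p') : Step D (sum I p) lam p'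
  | const {A : K} {lam : Label Act} {p' : CCS Act K} (h : Step D (D A) lam p') :
      Step D (const A) lam p'

/-- The constants are those of `K` together with one further constant `none`, which denotes
`τ^∞` and has the defining equation `τ^∞ ≝ τ.τ^∞`. The other constants are defined by `D`. -/
def defs (D : K → CCS Act (Option K)) : Option K → CCS Act (Option K)
  | none => pre ActTau.tau (const none)
  | some A => D A

end CCS

/-! ### Finite CCS -/

/-- Terms of finite CCS. -/
inductive CCSf (Act : Type u) : Type u
  | nil : CCSf Act
  | one : CCSf Act
  | add (p q : CCSf Act) : CCSf Act
  | pre (μ : ActTau Act) (p : CCSf Act) : CCSf Act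
  | tauInf : CCSf Act

namespace CCSf

variable {Act : Type u} {K : Type v}

/-- Finite CCS as a sublanguage of CCS. -/
def toCCS : CCSf Act → CCS Act (Option K)
  | nil => CCS.nil
  | one => CCS.one
  | add p q => CCS.add p.toCCS q.toCCS
  | pre μ p => CCS.pre μ p.toCCS
  | tauInf => CCS.const none

/-- The server testing preorder on finite terms; the clients range over all CCS terms. -/
def SvrLE (co : Act → Act) (D : K → CCS Act (Option K)) (p q : CCSf Act) : Prop :=
  ServerLE co (CCS.Step (CCS.defs D)) p.toCCS q.toCCS

/-- Precongruences on finite CCS: preorders preserved by all the operators. -/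
structure IsPrecongruence (R : CCSf Act → CCSf Act → Prop) : Prop where
  refl : ∀ p, R p p
  trans : ∀ p q r, R p q → R q r → R p r
  pre : ∀ μ p q, R p q → R (CCSf.pre μ p) (CCSf.pre μ q)
  add : ∀ p p' q q', R p p' → R q q' → R (CCSf.add p q) (CCSf.add p' q')

/-- The server precongruence: the largest precongruence on finite CCS that is contained in
the server preorder (see `svrPrecong_isGreatest`). -/
def SvrPrecong (co : Act → Act) (D : K → CCS Act (Option K)) (p q : CCSf Act) : Prop :=
  ∃ R : CCSf Act → CCSf Act → Prop,
    IsPrecongruence R ∧ (∀ p q, R p q → SvrLE co D p q) ∧ R p q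

/-- `p` cannot immediately report success. -/
def NotOk (D : K → CCS Act (Option K)) (p : CCSf Act) : Prop :=
  ¬ ∃ p', CCS.Step (CCS.defs D) p.toCCS Label.ok p'

/-! ### Inequational theories -/

/-- `Derivable E p q`: the inequation `p ≤ q` is derivable by inequational reasoning from the
closed instances `E` of a set of inequations. -/
inductive Derivable (E : CCSf Act → CCSf Act → Prop) : CCSf Act → CCSf Act → Prop
  | ax {p q : CCSf Act} (h : E p q) : Derivable E p q
  | refl (p : CCSf Act) : Derivable E p p
  | trans {p q r : CCSf Act} (h : Derivable E p q) (h' : Derivable E q r) : Derivable E p r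
  | pre (μ : ActTau Act) {p q : CCSf Act} (h : Derivable E p q) :
      Derivable E (CCSf.pre μ p) (CCSf.pre μ q)
  | add {p p' q q' : CCSf Act} (h : Derivable E p p') (h' : Derivable E q q') :
      Derivable E (CCSf.add p q) (CCSf.add p' q')

/-- Instances of the standard equations: the equations of an idempotent commutative monoid,
and (S1a), (S2), (S3). The hypotheses `NotOk` express that the variable ranges only over
processes that cannot immediately report success. -/
inductive StdEq (D : K → CCS Act (Option K)) : CCSf Act → CCSf Act → Prop
  | assoc (x y z : CCSf Act) : StdEq D (add (add x y) z) (add x (add y z))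
  | comm (x y : CCSf Act) : StdEq D (add x y) (add y x)
  | unit (x : CCSf Act) : StdEq D (add x nil) x
  | idem (x : CCSf Act) : StdEq D (add x x) x
  | s1a (μ : ActTau Act) (x y : CCSf Act) (hx : NotOk D x) :
      StdEq D (add (pre μ x) (pre μ y)) (pre μ (add (pre .tau x) (pre .tau y)))
  | s2 (x y : CCSf Act) (hx : NotOk D x) :
      StdEq D (add x (pre .tau y)) (add (pre .tau (add x y)) (pre .tau y))
  | s3 (μ : ActTau Act) (x y z : CCSf Act) :
      StdEq D (add (pre μ x) (pre .tau (add (pre μ y) z)))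
        (pre .tau (add (add (pre μ x) (pre μ y)) z))

/-- Instances of the standard inequations (S1b), (S4), (S5). -/
inductive StdLE : CCSf Act → CCSf Act → Prop
  | s1b (x : CCSf Act) : StdLE (pre .tau x) (pre .tau (pre .tau x))
  | s4 (x y : CCSf Act) : StdLE (add (pre .tau x) (pre .tau y)) x
  | s5 (x : CCSf Act) : StdLE tauInf x

/-- The theory SVR: the standard (in)equations together with (SVR1), `1 = 0`. An equation is
a pair of inequations. -/
inductive SVR (D : K → CCS Act (Option K)) : CCSf Act → CCSf Act → Prop
  | stdLE {p q : CCSf Act} (h : StdLE p q) : SVR D p q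
  | stdEq {p q : CCSf Act} (h : StdEq D p q) : SVR D p q
  | stdEq_symm {p q : CCSf Act} (h : StdEq D p q) : SVR D q p
  | svr1 : SVR D one nil
  | svr1_symm : SVR D nil one

/-- `SvrPrecong` is indeed the largest precongruence contained in the server preorder. -/
theorem svrPrecong_isGreatest (co : Act → Act) (D : K → CCS Act (Option K)) :
    IsGreatest {R : CCSf Act → CCSf Act → Prop |
      IsPrecongruence R ∧ ∀ p q, R p q → SvrLE co D p q} (SvrPrecong co D) := by
  -- a context closure of `SvrLE` contains every precongruence inside `SvrLE`
  let R : CCSf Act → CCSf Act → Prop := fun p q =>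
    ∀ C : CCSf Act → CCSf Act,
      (∀ S : CCSf Act → CCSf Act → Prop, IsPrecongruence S →
        ∀ a b, S a b → S (C a) (C b)) → SvrLE co D (C p) (C q)
  have hR : IsPrecongruence R := by
    refine ⟨fun p C _ r h => h, fun p q r h h' C hC t ht => h' C hC t (h C hC t ht),
      fun μ p q h C hC => h (fun x => C (CCSf.pre μ x))
        (fun S hS a b hab => hC S hS _ _ (hS.pre _ _ _ hab)), ?_⟩
    intro p p' q q' h h' C hC t ht
    have h1 := h (fun x => C (CCSf.add x q))
      (fun S hS a b hab => hC S hS _ _ (hS.add _ _ _ _ hab (hS.refl _))) t ht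
    exact h' (fun x => C (CCSf.add p' x))
      (fun S hS a b hab => hC S hS _ _ (hS.add _ _ _ _ (hS.refl _) hab)) t h1
  have hle : ∀ p q, R p q → SvrLE co D p q := fun p q h => h id (fun _ _ _ _ h => h)
  have heq : SvrPrecong co D = R := by
    funext p q
    refine propext ⟨?_, fun h => ⟨R, hR, hle, h⟩⟩
    rintro ⟨S, hS, hSle, h⟩ C hC
    exact hSle _ _ (hC S hS _ _ h)
  refine ⟨?_, fun S hS p q h => ⟨S, hS.1, hS.2, h⟩⟩
  rw [heq]
  exact ⟨hR, hle⟩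

end CCSf

end ServerTesting

/-! The semantic counterpart of `SvrPrecong` is `StabLE`: q passes every client that p passes, and q
has an initial τ-move only if p has one. The second clause is what + detects: if only q is unstable,
then for a fresh action a the client `a̅.1` is passed by p + a.0 but not by q + a.0, whose τ-move
discards a (`SvrPrecong.stabLE`). Conversely, `StabLE` is a precongruence containing all axioms,
which gives soundness. Must-testing is handled through `Passes`, a well-founded form that allows
induction even for infinitary clients.

Completeness (`mk_le_mk_of_stabLE`) is algebra in `Alg`, the ordered quotient by provable equality,
by induction on the size of q. A divergent p equals τ^∞, the least element. Otherwise each summand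
μ.q' of q has a lower bound absorbed by p (`exists_lower_bound`). For visible a it is a prefixed to
the internal choice of all weak a-derivatives of p: q' passes every client that they all pass. For τ
it is p itself, because an unstable p equals τ.p. The sum y of these bounds satisfies y ≤ q and p +
y = p, and p ≤ y remains. If q is unstable, one bound is p and y = p. If q is stable, p silently
reaches a stable p' whose initial actions are all actions of q (`exists_stable`); y absorbs p', and
S2 with S4 gives p ≤ y. -/

namespace ServerTesting

/-! ### An inductive characterization of `Must` -/

section Pass

variable {Act : Type u} {P : Type v}

/-- Every maximal computation from the state `s` of a composition reaches a state in which the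
client reports success, expressed inductively. -/
inductive Pass (co : Act → Act) (Tr : P → Label Act → P → Prop) : P × P → Prop
  | ok {s : P × P} (h : ∃ r', Tr s.2 Label.ok r') : Pass co Tr s
  | step {s : P × P} (hs : ∃ s', Par co Tr s Label.tau s')
      (h : ∀ s', Par co Tr s Label.tau s' → Pass co Tr s') : Pass co Tr s

variable {co : Act → Act} {Tr : P → Label Act → P → Prop}

theorem Pass.exists_ok {s : P × P} (h : Pass co Tr s) :
    ∀ (N : ℕ∞) (c : ℕ → P × P), IsMaxComputation co Tr s.1 s.2 N c →
      ∃ k : ℕ, (k : ℕ∞) ≤ N ∧ ∃ r', Tr (c k).2 Label.ok r' := by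
  induction h with
  | @ok s h =>
    intro N c hc
    exact ⟨0, by simp, by rw [hc.start]; exact h⟩
  | @step s hs h ih =>
    intro N c hc
    have h0 : c 0 = s := hc.start
    have hN : (0 : ℕ∞) < N := by
      rw [pos_iff_ne_zero]
      rintro rfl
      exact hc.maximal 0 (by simp) (by rwa [h0])
    obtain ⟨N', rfl⟩ : ∃ N' : ℕ∞, N = N' + 1 := ⟨N - 1, (tsub_add_cancel_of_le
      (Order.one_le_iff_pos.2 hN)).symm⟩
    have h1 : Par co Tr s Label.tau (c 1) := by
      have := hc.step 0 (by simp)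
      rwa [h0] at this
    obtain ⟨k, hk, hk'⟩ := ih _ h1 N' (fun i => c (i + 1))
      { start := rfl
        step := fun i hi => hc.step (i + 1) (by
          push_cast
          exact (ENat.add_lt_add_iff_right (by simp)).2 hi)
        maximal := fun n hn => hc.maximal (n + 1) (by rw [hn]; push_cast; rfl) }
    exact ⟨k + 1, by push_cast; gcongr, hk'⟩

/-- From a state outside `Pass` that can move, some successor is again outside `Pass`. Following
such successors yields a maximal computation that never meets a successful client. -/
theorem must_iff_pass {p r : P} : Must co Tr p r ↔ Pass co Tr (p, r) := by
  classical
  refine ⟨fun hm => ?_, fun h N c hc => h.exists_ok N c hc⟩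
  by_contra hp
  let f : P × P → P × P := fun s =>
    if h : ∃ s', Par co Tr s Label.tau s' ∧ ¬ Pass co Tr s' then h.choose else s
  have hf : ∀ s, ¬ Pass co Tr s → ¬ Pass co Tr (f s) := by
    intro s hs
    by_cases h : ∃ s', Par co Tr s Label.tau s' ∧ ¬ Pass co Tr s'
    · simp only [f, dif_pos h]
      exact h.choose_spec.2
    · simpa only [f, dif_neg h] using hs
  have hstep : ∀ s, ¬ Pass co Tr s → (∃ s', Par co Tr s Label.tau s') →
      Par co Tr s Label.tau (f s) := by
    intro s hs hs'
    have h : ∃ s', Par co Tr s Label.tau s' ∧ ¬ Pass co Tr s' := by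
      by_contra h
      push Not at h
      exact hs (Pass.step hs' h)
    simp only [f, dif_pos h]
    exact h.choose_spec.1
  let c : ℕ → P × P := fun n => f^[n] (p, r)
  have hc : ∀ n, c (n + 1) = f (c n) := fun n => Function.iterate_succ_apply' f n _
  have hcp : ∀ n, ¬ Pass co Tr (c n) := by
    intro n
    induction n with
    | zero => exact hp
    | succ n ih => rw [hc]; exact hf _ ih
  have hno : ∀ N, ¬ IsMaxComputation co Tr p r N c := by
    intro N hN
    obtain ⟨k, -, hk⟩ := hm N c hN
    exact hcp k (Pass.ok hk)
  -- A run that gets stuck is cut at its first stuck state; otherwise it is infinite.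
  by_cases hst : ∃ n, ¬ ∃ s', Par co Tr (c n) Label.tau s'
  · refine hno (Nat.find hst : ℕ) ⟨rfl, fun i hi => ?_, fun n hn => ?_⟩
    · rw [hc]
      exact hstep _ (hcp i) (not_not.1 (Nat.find_min hst (by exact_mod_cast hi)))
    · have : Nat.find hst = n := by exact_mod_cast hn
      rw [← this]
      exact Nat.find_spec hst
  · push Not at hst
    refine hno ⊤ ⟨rfl, fun i _ => ?_, fun n hn => absurd hn (by simp)⟩
    rw [hc]
    exact hstep _ (hcp i) (hst i)

end Pass

/-! ### Transitions of clients -/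

namespace CCS

variable {Act : Type u} {K : Type v} {D : K → CCS Act K} {lam : Label Act} {p q s : CCS Act K}

@[simp]
theorem step_nil : ¬ Step D nil lam s := by
  rintro ⟨⟩
  rename_i i _
  exact absurd i.2 (Set.notMem_empty i.1)

@[simp]
theorem step_one : Step D one lam s ↔ lam = Label.ok ∧ s = nil := by
  constructor
  · rintro ⟨⟩
    exact ⟨rfl, rfl⟩
  · rintro ⟨rfl, rfl⟩
    exact Step.ok

@[simp]
theorem step_pre {μ : ActTau Act} :
    Step D (pre μ p) lam s ↔ lam = Label.ofActTau μ ∧ s = p := by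
  constructor
  · rintro ⟨⟩
    exact ⟨rfl, rfl⟩
  · rintro ⟨rfl, rfl⟩
    exact Step.pre _ _

@[simp]
theorem step_const {A : K} : Step D (const A) lam s ↔ Step D (D A) lam s :=
  ⟨fun h => by cases h; assumption, Step.const⟩

@[simp]
theorem step_add : Step D (add p q) lam s ↔ Step D p lam s ∨ Step D q lam s := by
  constructor
  · intro h
    cases h with
    | sum i h =>
      dsimp only at h
      split at h
      · exact Or.inl h
      · exact Or.inr h
  · rintro (h | h)
    · exact Step.sum (⟨0, by simp⟩ : ({0, 1} : Set ℕ)) (by simpa using h)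
    · exact Step.sum (⟨1, by simp⟩ : ({0, 1} : Set ℕ)) (by simpa using h)

/-- The client that offers the complements of the actions in a list, and reports success after
any interaction. -/
def offer (co : Act → Act) : List Act → CCS Act K
  | [] => nil
  | a :: l => add (pre (.act (co a)) one) (offer co l)

@[simp]
theorem step_offer {co : Act → Act} {l : List Act} :
    Step D (offer co l) lam s ↔ ∃ a ∈ l, lam = Label.act (co a) ∧ s = one := by
  induction l with
  | nil => simp [offer]
  | cons a l ih => simp [offer, ih]

end CCS

/-! ### Transitions of finite terms -/

namespace CCSf

variable {Act : Type u} {K : Type v}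

/-- The transitions of a finite term, other than success. -/
def summands : CCSf Act → List (ActTau Act × CCSf Act)
  | nil => []
  | one => []
  | add p q => p.summands ++ q.summands
  | pre μ p => [(μ, p)]
  | tauInf => [(.tau, tauInf)]

/-- The transition relation of finite terms, without success. -/
def Tr (p : CCSf Act) (μ : ActTau Act) (p' : CCSf Act) : Prop := (μ, p') ∈ p.summands

section Tr

variable {p q s : CCSf Act} {μ ν : ActTau Act}

@[simp] theorem tr_nil : ¬ Tr nil μ s := by simp [Tr, summands]

@[simp] theorem tr_one : ¬ Tr one μ s := by simp [Tr, summands]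

@[simp] theorem tr_add : Tr (add p q) μ s ↔ Tr p μ s ∨ Tr q μ s := by simp [Tr, summands]

@[simp] theorem tr_pre : Tr (pre ν p) μ s ↔ μ = ν ∧ s = p := by simp [Tr, summands]

@[simp] theorem tr_tauInf : Tr (tauInf : CCSf Act) μ s ↔ μ = .tau ∧ s = tauInf := by
  simp [Tr, summands]

end Tr

theorem step_toCCS {D : K → CCS Act (Option K)} {p : CCSf Act} {μ : ActTau Act}
    {s : CCS Act (Option K)} :
    CCS.Step (CCS.defs D) p.toCCS (.ofActTau μ) s ↔ ∃ p', Tr p μ p' ∧ s = p'.toCCS := by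
  induction p with
  | nil => simp [toCCS]
  | one => simp [toCCS]
  | add p q hp hq => simp [toCCS, hp, hq, or_and_right, exists_or]
  | pre ν p => simp [toCCS]
  | tauInf => simp [toCCS, CCS.defs]

/-- The visible actions occurring in a term. -/
def acts : CCSf Act → List Act
  | nil => []
  | one => []
  | add p q => p.acts ++ q.acts
  | pre (.act a) p => a :: p.acts
  | pre .tau p => p.acts
  | tauInf => []

theorem Tr.mem_acts {p p' : CCSf Act} {a : Act} (h : Tr p (.act a) p') : a ∈ p.acts := by
  induction p with
  | nil => simp at h
  | one => simp at h
  | add p q hp hq =>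
    simp only [tr_add] at h
    simp only [acts, List.mem_append]
    exact h.imp hp hq
  | pre ν p =>
    simp only [tr_pre] at h
    obtain ⟨rfl, rfl⟩ := h
    simp [acts]
  | tauInf => simp at h

theorem Tr.acts_subset {p p' : CCSf Act} {μ : ActTau Act} (h : Tr p μ p') :
    p'.acts ⊆ p.acts := by
  induction p with
  | nil => simp at h
  | one => simp at h
  | add p q hp hq =>
    simp only [tr_add] at h
    intro a ha
    simp only [acts, List.mem_append]
    exact h.imp (fun h => hp h ha) (fun h => hq h ha)
  | pre ν p =>
    simp only [tr_pre] at h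
    obtain ⟨rfl, rfl⟩ := h
    cases μ <;> simp [acts]
  | tauInf =>
    simp only [tr_tauInf] at h
    simp [h.2]

/-! ### Stability, convergence and weak moves. -/

/-- The term has an internal move. -/
def Unstable (p : CCSf Act) : Prop := ∃ p', Tr p .tau p'

/-- The term has no infinite sequence of internal moves. -/
inductive Conv : CCSf Act → Prop
  | intro {p : CCSf Act} (h : ∀ p', Tr p .tau p' → Conv p') : Conv p

theorem Conv.tr {p p' : CCSf Act} (h : Conv p) (h' : Tr p .tau p') : Conv p' := by
  cases h with
  | intro h => exact h _ h'

theorem Conv.of_not_unstable {p : CCSf Act} (h : ¬ Unstable p) : Conv p :=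
  ⟨fun p' h' => absurd ⟨p', h'⟩ h⟩

/-- Zero or more internal moves. -/
abbrev TauStar : CCSf Act → CCSf Act → Prop := Relation.ReflTransGen (fun p p' => Tr p .tau p')

/-- An `a`-move after zero or more internal moves. -/
def WTr (p : CCSf Act) (a : Act) (p' : CCSf Act) : Prop :=
  ∃ p₁, TauStar p p₁ ∧ Tr p₁ (.act a) p'

theorem wtr_iff {p p' : CCSf Act} {a : Act} :
    WTr p a p' ↔ Tr p (.act a) p' ∨ ∃ p₁, Tr p .tau p₁ ∧ WTr p₁ a p' := by
  constructor
  · rintro ⟨p₁, h, h'⟩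
    rcases Relation.ReflTransGen.cases_head h with rfl | ⟨p₂, h₂, h₃⟩
    · exact Or.inl h'
    · exact Or.inr ⟨p₂, h₂, p₁, h₃, h'⟩
  · rintro (h | ⟨p₂, h₂, p₁, h₃, h'⟩)
    · exact ⟨p, .refl, h⟩
    · exact ⟨p₁, .head h₂ h₃, h'⟩

/-! ### Passing tests -/

section Passes

/-- The finite term `p` satisfies the client `r`, expressed inductively. -/
inductive Passes (co : Act → Act) (D : K → CCS Act (Option K)) :
    CCSf Act → CCS Act (Option K) → Prop
  | ok {p : CCSf Act} {r : CCS Act (Option K)}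
      (h : ∃ r', CCS.Step (CCS.defs D) r Label.ok r') : Passes co D p r
  | step {p : CCSf Act} {r : CCS Act (Option K)}
      (hs : Unstable p ∨ (∃ r', CCS.Step (CCS.defs D) r Label.tau r') ∨
        ∃ a p' r', Tr p (.act a) p' ∧ CCS.Step (CCS.defs D) r (Label.act (co a)) r')
      (hl : ∀ p', Tr p .tau p' → Passes co D p' r)
      (hr : ∀ r', CCS.Step (CCS.defs D) r Label.tau r' → Passes co D p r')
      (hlr : ∀ a p' r', Tr p (.act a) p' → CCS.Step (CCS.defs D) r (Label.act (co a)) r' →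
        Passes co D p' r') : Passes co D p r

variable {co : Act → Act} {D : K → CCS Act (Option K)}

theorem passes_iff_pass {p : CCSf Act} {r : CCS Act (Option K)} :
    Passes co D p r ↔ Pass co (CCS.Step (CCS.defs D)) (p.toCCS, r) := by
  constructor
  · intro h
    induction h with
    | ok h => exact .ok h
    | @step p r hs hl hr hlr ihl ihr ihlr =>
      refine .step ?_ ?_
      · rcases hs with ⟨p', h⟩ | ⟨r', h⟩ | ⟨a, p', r', h, h'⟩
        · exact ⟨_, .left _ (step_toCCS.2 ⟨p', h, rfl⟩)⟩
        · exact ⟨_, .right _ h⟩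
        · exact ⟨_, .synch (step_toCCS.2 ⟨p', h, rfl⟩) h'⟩
      · rintro s' (⟨_, h⟩ | ⟨_, h⟩ | ⟨h, h'⟩)
        · obtain ⟨p', h₁, rfl⟩ := step_toCCS.1 h
          exact ihl _ h₁
        · exact ihr _ h
        · obtain ⟨p', h₁, rfl⟩ := step_toCCS.1 h
          exact ihlr _ _ _ h₁ h'
  · intro h
    generalize hs : (p.toCCS, r) = s at h
    induction h generalizing p r with
    | ok h =>
      subst hs
      exact .ok h
    | step hs' h ih =>
      subst hs
      refine .step ?_ ?_ ?_ ?_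
      · obtain ⟨s', ⟨_, h⟩ | ⟨_, h⟩ | ⟨h, h'⟩⟩ := hs'
        · obtain ⟨p', h₁, rfl⟩ := step_toCCS.1 h
          exact Or.inl ⟨_, h₁⟩
        · exact Or.inr (Or.inl ⟨_, h⟩)
        · obtain ⟨p', h₁, rfl⟩ := step_toCCS.1 h
          exact Or.inr (Or.inr ⟨_, _, _, h₁, h'⟩)
      · exact fun p' h => ih _ (.left _ (step_toCCS.2 ⟨p', h, rfl⟩)) rfl
      · exact fun r' h => ih _ (.right _ h) rfl
      · exact fun a p' r' h h' => ih _ (.synch (step_toCCS.2 ⟨p', h, rfl⟩) h') rfl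

theorem svrLE_iff {p q : CCSf Act} :
    SvrLE co D p q ↔ ∀ r, Passes co D p r → Passes co D q r := by
  simp only [SvrLE, ServerLE, must_iff_pass, passes_iff_pass]

/-- The client can report success. -/
def Happy (D : K → CCS Act (Option K)) (r : CCS Act (Option K)) : Prop :=
  ∃ r', CCS.Step (CCS.defs D) r Label.ok r'

theorem happy_one : Happy D CCS.one := ⟨_, CCS.Step.ok⟩

variable {p q p' : CCSf Act} {r r' : CCS Act (Option K)}

theorem Passes.progress (h : Passes co D p r) (hr : ¬ Happy D r) :
    Unstable p ∨ (∃ r', CCS.Step (CCS.defs D) r Label.tau r') ∨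
      ∃ a p' r', Tr p (.act a) p' ∧ CCS.Step (CCS.defs D) r (Label.act (co a)) r' := by
  cases h with
  | ok h => exact absurd h hr
  | step h => exact h

theorem Passes.left (h : Passes co D p r) (h' : Tr p .tau p') : Passes co D p' r := by
  cases h with
  | ok h => exact .ok h
  | step _ h => exact h _ h'

theorem Passes.right (h : Passes co D p r) (hr : ¬ Happy D r)
    (h' : CCS.Step (CCS.defs D) r Label.tau r') : Passes co D p r' := by
  cases h with
  | ok h => exact absurd h hr
  | step _ _ h => exact h _ h'

theorem Passes.synch (h : Passes co D p r) (hr : ¬ Happy D r) {a : Act}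
    (hp : Tr p (.act a) p') (h' : CCS.Step (CCS.defs D) r (Label.act (co a)) r') :
    Passes co D p' r' := by
  cases h with
  | ok h => exact absurd h hr
  | step _ _ _ h => exact h _ _ _ hp h'

/-- To show that `q` passes the tests in a set `S` closed under internal moves of the client, it
suffices to consider the moves of `q`. -/
theorem Passes.transfer {S : CCS Act (Option K) → Prop}
    (hS : ∀ r, ¬ Happy D r → S r →
      (∀ r', CCS.Step (CCS.defs D) r Label.tau r' → S r') ∧
      (Unstable q ∨ (∃ r', CCS.Step (CCS.defs D) r Label.tau r') ∨
        ∃ a p' r', Tr q (.act a) p' ∧ CCS.Step (CCS.defs D) r (Label.act (co a)) r') ∧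
      (∀ q', Tr q .tau q' → Passes co D q' r) ∧
      ∀ a q' r', Tr q (.act a) q' → CCS.Step (CCS.defs D) r (Label.act (co a)) r' →
        Passes co D q' r')
    (h : Passes co D p r) (hr : S r) : Passes co D q r := by
  -- The derivation for p only serves to bound the client's own τ-moves (`ihr`); all moves involving
  -- q are covered by `hS`.
  induction h with
  | ok h => exact .ok h
  | @step p r hs hl hr' hlr ihl ihr ihlr =>
    by_cases hh : Happy D r
    · exact .ok hh
    obtain ⟨h1, h2, h3, h4⟩ := hS r hh hr
    exact .step h2 h3 (fun r' hr' => ihr _ hr' (h1 _ hr')) h4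

/-- To show that `q` passes all tests passed by `p`, it suffices to consider the moves of `q`. -/
theorem Passes.mono (hq : ∀ r, ¬ Happy D r → Passes co D p r →
      (Unstable q ∨ (∃ r', CCS.Step (CCS.defs D) r Label.tau r') ∨
        ∃ a p' r', Tr q (.act a) p' ∧ CCS.Step (CCS.defs D) r (Label.act (co a)) r') ∧
      (∀ q', Tr q .tau q' → Passes co D q' r) ∧
      ∀ a q' r', Tr q (.act a) q' → CCS.Step (CCS.defs D) r (Label.act (co a)) r' →
        Passes co D q' r')
    (h : Passes co D p r) : Passes co D q r :=
  h.transfer (S := Passes co D p)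
    (fun r hr hp => ⟨fun _ h => hp.right hr h, hq r hr hp⟩) h

theorem Passes.congr (h : ∀ μ s, Tr p μ s ↔ Tr q μ s) (hp : Passes co D p r) :
    Passes co D q r := by
  refine hp.mono fun r hr hp => ⟨?_, fun q' h' => hp.left ((h _ _).2 h'),
    fun a q' r' h' h'' => hp.synch hr ((h _ _).2 h') h''⟩
  simpa only [Unstable, h] using hp.progress hr

/-- Since τ^∞ moves to itself, a well-founded derivation for it requires a client that already
reports success. -/
theorem Passes.of_tauInf (h : Passes co D tauInf r) : Passes co D p r := by
  generalize hq : (tauInf : CCSf Act) = q at h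
  induction h with
  | ok h => exact .ok h
  | step _ _ _ _ ihl =>
    subst hq
    exact ihl _ (by simp) rfl

theorem passes_tau_add_tau :
    Passes co D (add (pre .tau p) (pre .tau q)) r ↔ Passes co D p r ∧ Passes co D q r := by
  constructor
  · exact fun h => ⟨h.left (by simp), h.left (by simp)⟩
  · rintro ⟨hp, hq⟩
    refine hp.transfer (S := fun r => Passes co D p r ∧ Passes co D q r)
      (fun r hr h => ⟨fun r' h' => ⟨h.1.right hr h', h.2.right hr h'⟩,
        Or.inl ⟨p, by simp⟩, ?_, by simp⟩) ⟨hp, hq⟩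
    simp only [tr_add, tr_pre]
    rintro q' (⟨-, rfl⟩ | ⟨-, rfl⟩)
    exacts [h.1, h.2]

theorem passes_tau : Passes co D (pre .tau p) r ↔ Passes co D p r := by
  constructor
  · exact fun h => h.left (by simp)
  · intro h
    have : Passes co D (add (pre .tau p) (pre .tau p)) r := passes_tau_add_tau.2 ⟨h, h⟩
    exact this.congr (by simp)

/-- Semantic form of S2: y is silently reachable, so it must pass alone, and offering its moves next
to those of x then demands nothing new. Progress of x + y is inherited from y. -/
theorem passes_add_tau {x y : CCSf Act} :
    Passes co D (add x (pre .tau y)) r ↔ Passes co D (add x y) r ∧ Passes co D y r := by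
  constructor
  · intro h
    refine ⟨h.mono fun r hr h => ?_, h.left (by simp)⟩
    have hy : Passes co D y r := h.left (by simp)
    refine ⟨?_, ?_, ?_⟩
    · rcases hy.progress hr with ⟨y', h⟩ | h | ⟨a, y', r', h, h'⟩
      · exact Or.inl ⟨y', by simp [h]⟩
      · exact Or.inr (Or.inl h)
      · exact Or.inr (Or.inr ⟨a, y', r', by simp [h], h'⟩)
    · simp only [tr_add]
      rintro q' (h' | h')
      · exact h.left (by simp [h'])
      · exact hy.left h'
    · simp only [tr_add]
      rintro a q' r' (h' | h') h''
      · exact h.synch hr (by simp [h']) h''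
      · exact hy.synch hr h' h''
  · rintro ⟨hp, hq⟩
    refine hp.transfer (S := fun r => Passes co D (add x y) r ∧ Passes co D y r)
      (fun r hr h => ⟨fun r' h' => ⟨h.1.right hr h', h.2.right hr h'⟩,
        Or.inl ⟨y, by simp⟩, ?_, ?_⟩) ⟨hp, hq⟩
    · simp only [tr_add, tr_pre]
      rintro q' (h' | ⟨-, rfl⟩)
      · exact h.1.left (by simp [h'])
      · exact h.2
    · simp only [tr_add, tr_pre]
      rintro a q' r' (h' | ⟨h', -⟩) h''
      · exact h.1.synch hr (by simp [h']) h''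
      · cases h'

theorem passes_s3 {μ : ActTau Act} {x y z : CCSf Act} :
    Passes co D (add (pre μ x) (pre .tau (add (pre μ y) z))) r ↔
      Passes co D (add (add (pre μ x) (pre μ y)) z) r := by
  rw [passes_add_tau]
  constructor
  · exact fun h => h.1.congr (by simp [or_assoc])
  · refine fun h => ⟨h.congr (by simp [or_assoc]), h.mono fun r hr h => ⟨?_, ?_, ?_⟩⟩
    · rcases h.progress hr with ⟨y', h⟩ | h | ⟨a, y', r', h, h'⟩
      · simp only [tr_add, tr_pre] at h
        rcases h with (⟨rfl, -⟩ | ⟨rfl, -⟩) | h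
        · exact Or.inl ⟨y, by simp⟩
        · exact Or.inl ⟨y, by simp⟩
        · exact Or.inl ⟨y', by simp [h]⟩
      · exact Or.inr (Or.inl h)
      · simp only [tr_add, tr_pre] at h
        rcases h with (⟨rfl, -⟩ | ⟨rfl, -⟩) | h
        · exact Or.inr (Or.inr ⟨a, y, r', by simp, h'⟩)
        · exact Or.inr (Or.inr ⟨a, y, r', by simp, h'⟩)
        · exact Or.inr (Or.inr ⟨a, y', r', by simp [h], h'⟩)
    · simp only [tr_add]
      rintro q' (h' | h')
      · exact h.left (by simpa using .inl (.inr (by simpa using h')))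
      · exact h.left (by simp [h'])
    · simp only [tr_add]
      rintro a q' r' (h' | h') h''
      · exact h.synch hr (by simpa using .inl (.inr (by simpa using h'))) h''
      · exact h.synch hr (by simp [h']) h''

theorem Passes.pre_mono (h : ∀ r, Passes co D p r → Passes co D q r) {μ : ActTau Act}
    (hp : Passes co D (pre μ p) r) : Passes co D (pre μ q) r := by
  refine hp.mono fun r hr hp => ⟨?_, ?_, ?_⟩
  · simpa [Unstable] using hp.progress hr
  · simp only [tr_pre]
    rintro q' ⟨rfl, rfl⟩
    exact h _ (hp.left (by simp))
  · simp only [tr_pre]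
    rintro a q' r' ⟨rfl, rfl⟩ h'
    exact h _ (hp.synch hr (by simp) h')

/-- An unstable p cannot deadlock, so dropping q only removes obligations. -/
theorem Passes.of_add (hu : Unstable p) (h : Passes co D (add p q) r) : Passes co D p r :=
  h.mono fun _ hr h => ⟨Or.inl hu, fun _ h' => h.left (by simp [h']),
    fun _ _ _ h' h'' => h.synch hr (by simp [h']) h''⟩

theorem not_passes_nil : ¬ Passes co D p CCS.nil := by
  intro h
  generalize hr : (CCS.nil : CCS Act (Option K)) = r at h
  induction h with
  | ok h => subst hr; simp at h
  | step hs hl hr' hlr ihl =>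
    subst hr
    rcases hs with ⟨p', h⟩ | h | h
    · exact ihl _ h rfl
    · simp at h
    · simp at h

end Passes

/-! ### Properties of convergent servers visible to clients -/

section Tests

variable {co : Act → Act} {D : K → CCS Act (Option K)} {p q : CCSf Act}

/-- The client `τ.1` detects divergence: only an infinite run of server moves can keep it from its
own τ-move. -/
theorem Conv.passes_tau_one (hp : Conv p) : Passes co D p (CCS.pre .tau CCS.one) := by
  induction hp with
  | intro hc ih =>
    refine .step (Or.inr (Or.inl ⟨CCS.one, by simp⟩)) ih ?_ (by simp)
    intro r' hr'
    obtain rfl : r' = CCS.one := by simpa using hr'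
    exact .ok happy_one

theorem Passes.conv (h : Passes co D p (CCS.pre .tau CCS.one)) : Conv p := by
  generalize hr : (CCS.pre .tau CCS.one : CCS Act (Option K)) = r at h
  induction h with
  | ok h => subst hr; simp at h
  | step _ _ _ _ ihl => exact ⟨fun p' h' => ihl p' h' hr⟩

theorem Conv.of_passes (hp : Conv p) (h : ∀ r, Passes co D p r → Passes co D q r) : Conv q :=
  (h _ hp.passes_tau_one).conv

/-- A convergent server passes the test `a̅.t + τ.1` if all its weak `a`-derivatives pass `t`. -/
theorem Conv.passes_probe (hco : Function.Injective co) (hp : Conv p) {a : Act}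
    {t : CCS Act (Option K)} (h : ∀ p', WTr p a p' → Passes co D p' t) :
    Passes co D p (CCS.add (CCS.pre (.act (co a)) t) (CCS.pre .tau CCS.one)) := by
  induction hp with
  | @intro p hc ih =>
    refine .step (Or.inr (Or.inl ⟨CCS.one, by simp⟩)) ?_ ?_ ?_
    · exact fun p' hp' => ih p' hp' fun p'' h'' => h _ (wtr_iff.2 (Or.inr ⟨p', hp', h''⟩))
    · intro r' hr'
      obtain rfl : r' = CCS.one := by simpa using hr'
      exact .ok happy_one
    · intro b p' r' hp' hr'
      obtain ⟨hb, rfl⟩ : co b = co a ∧ r' = t := by simpa using hr'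
      obtain rfl := hco hb
      exact h _ (wtr_iff.2 (Or.inl hp'))

/-- The probe `a̅.t + τ.1` cannot report success yet, so synchronising on a must leave q' passing t.
-/
theorem passes_of_wtr (hco : Function.Injective co) (hp : Conv p)
    (h : ∀ r, Passes co D p r → Passes co D q r) {a : Act} {q' : CCSf Act}
    (hq : Tr q (.act a) q') {t : CCS Act (Option K)}
    (ht : ∀ p', WTr p a p' → Passes co D p' t) : Passes co D q' t :=
  (h _ (hp.passes_probe hco ht)).synch (by simp [Happy]) hq (by simp)

/-- Otherwise every stable term silently reachable from p has an initial action that q lacks. A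
client offering the complements of those actions is then passed by p, while the stable q deadlocks
with it. -/
theorem exists_stable (hco : Function.Injective co) (hp : Conv p)
    (h : ∀ r, Passes co D p r → Passes co D q r) (hq : ¬ Unstable q) :
    ∃ p', TauStar p p' ∧ ¬ Unstable p' ∧
      ∀ a p'', Tr p' (.act a) p'' → ∃ q', Tr q (.act a) q' := by
  classical
  by_contra hno
  push Not at hno
  -- Finitely many offers suffice, since derivatives of p only use actions occurring in p.
  let l : List Act := p.acts.filter fun a => ¬ ∃ q', Tr q (.act a) q'
  have key : ∀ p₁, Conv p₁ → TauStar p p₁ → p₁.acts ⊆ p.acts →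
      Passes co D p₁ (CCS.offer co l) := by
    intro p₁ hp₁
    induction hp₁ with
    | @intro p₁ hc ih =>
      intro hs hsub
      refine .step ?_ (fun p' h' => ih p' h' (hs.tail h') fun _ ha => hsub (h'.acts_subset ha))
        (by simp) ?_
      · by_cases hu : Unstable p₁
        · exact Or.inl hu
        · obtain ⟨a, p'', h1, h2⟩ := hno p₁ hs hu
          refine Or.inr (Or.inr ⟨a, p'', CCS.one, h1, ?_⟩)
          have : a ∈ p.acts := hsub h1.mem_acts
          simp only [CCS.step_offer, l]
          exact ⟨a, by simpa [this] using h2, by simp⟩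
      · intro a p' r' _ hr'
        obtain ⟨_, _, _, rfl⟩ := CCS.step_offer.1 hr'
        exact .ok happy_one
  have hl := h _ (key p hp .refl (List.Subset.refl _))
  rcases hl.progress (by simp [Happy]) with h1 | h1 | ⟨a, q', r', h1, h2⟩
  · exact hq h1
  · simp at h1
  · obtain ⟨b, hb, hab, -⟩ := CCS.step_offer.1 h2
    obtain rfl : a = b := hco (by simpa using hab)
    simp only [l, List.mem_filter, decide_eq_true_eq] at hb
    exact hb.2 ⟨q', h1⟩

/-! ### Soundness -/

/-- The characterization of the server precongruence: the server preorder, where moreover the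
larger term may be unstable only if the smaller one is. -/
structure StabLE (co : Act → Act) (D : K → CCS Act (Option K)) (p q : CCSf Act) : Prop where
  passes : ∀ r, Passes co D p r → Passes co D q r
  unstable : Unstable q → Unstable p

@[simp]
theorem unstable_add : Unstable (add p q) ↔ Unstable p ∨ Unstable q := by
  simp [Unstable, exists_or]

@[simp]
theorem unstable_pre_tau : Unstable (pre .tau p) := ⟨p, by simp⟩

/-- An unstable p passes the client by itself, hence so does p'. If p is stable then so is p', and
the weak derivatives of p seen by probes are its strong ones. -/
theorem StabLE.add_right (hco : Function.Injective co) {p p' : CCSf Act} (q : CCSf Act)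
    (h : StabLE co D p p') : StabLE co D (add p q) (add p' q) := by
  refine ⟨fun r hr => hr.mono fun r hr hpq => ?_, fun hu => ?_⟩
  swap
  · rw [unstable_add] at hu ⊢
    exact hu.imp_left h.unstable
  by_cases hu : Unstable p
  · have hp' := h.passes r (hpq.of_add hu)
    refine ⟨?_, ?_, ?_⟩
    · rcases hp'.progress hr with h1 | h1 | ⟨a, s, r', h1, h2⟩
      · exact Or.inl (unstable_add.2 (Or.inl h1))
      · exact Or.inr (Or.inl h1)
      · exact Or.inr (Or.inr ⟨a, s, r', by simp [h1], h2⟩)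
    · simp only [tr_add]
      rintro s (h1 | h1)
      · exact hp'.left h1
      · exact hpq.left (by simp [h1])
    · simp only [tr_add]
      rintro a s r' (h1 | h1) h2
      · exact hp'.synch hr h1 h2
      · exact hpq.synch hr (by simp [h1]) h2
  · have hu' : ¬ Unstable p' := fun h1 => hu (h.unstable h1)
    refine ⟨?_, ?_, ?_⟩
    · rcases hpq.progress hr with h1 | h1 | ⟨a, s, r', h1, h2⟩
      · rw [unstable_add] at h1 ⊢
        exact Or.inl (Or.inr (h1.resolve_left hu))
      · exact Or.inr (Or.inl h1)
      · rw [tr_add] at h1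
        rcases h1 with h1 | h1
        -- The stable p' can pass `a̅.1` only by synchronising on a, so it offers every initial
        -- action of p.
        · have h3 : Passes co D p (CCS.pre (.act (co a)) CCS.one) := by
            refine .step (Or.inr (Or.inr ⟨a, s, CCS.one, h1, by simp⟩))
              (fun p' h' => absurd ⟨p', h'⟩ hu) (by simp) ?_
            intro b s' r' _ h4
            obtain ⟨-, rfl⟩ : co b = co a ∧ r' = CCS.one := by simpa using h4
            exact .ok happy_one
          rcases (h.passes _ h3).progress (by simp [Happy]) with h4 | h4 | ⟨b, s', r'', h4, h5⟩
          · exact absurd h4 hu'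
          · simp at h4
          · obtain rfl : b = a := hco (by simp at h5; exact h5.1)
            exact Or.inr (Or.inr ⟨b, s', r', by simp [h4], h2⟩)
        · exact Or.inr (Or.inr ⟨a, s, r', by simp [h1], h2⟩)
    · simp only [tr_add]
      rintro s (h1 | h1)
      · exact absurd ⟨s, h1⟩ hu'
      · exact hpq.left (by simp [h1])
    · simp only [tr_add]
      rintro a s r' (h1 | h1) h2
      · refine passes_of_wtr hco (.of_not_unstable hu) h.passes h1 fun s' hs' => ?_
        rcases wtr_iff.1 hs' with h3 | ⟨p₁, h3, -⟩
        · exact hpq.synch hr (by simp [h3]) h2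
        · exact absurd ⟨p₁, h3⟩ hu
      · exact hpq.synch hr (by simp [h1]) h2

theorem StabLE.trans {s : CCSf Act} (h : StabLE co D p q) (h' : StabLE co D q s) :
    StabLE co D p s :=
  ⟨fun r hr => h'.passes r (h.passes r hr), fun hu => h.unstable (h'.unstable hu)⟩

theorem StabLE.of_tr (h : ∀ μ s, Tr p μ s ↔ Tr q μ s) : StabLE co D p q :=
  ⟨fun _ hr => hr.congr h, by simp [Unstable, h]⟩

theorem isPrecongruence_stabLE (hco : Function.Injective co) :
    IsPrecongruence (StabLE co D) where
  refl _ := ⟨fun _ h => h, id⟩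
  trans _ _ _ h h' := h.trans h'
  pre _ _ _ h := ⟨fun _ => Passes.pre_mono h.passes, by simp [Unstable]⟩
  add p p' q q' h h' := by
    have comm : ∀ x y : CCSf Act, StabLE co D (.add x y) (.add y x) :=
      fun x y => .of_tr (by simp [or_comm])
    exact (h.add_right hco q).trans ((comm _ _).trans ((h'.add_right hco p').trans (comm _ _)))

theorem StdEq.stabLE (h : StdEq D p q) : StabLE co D p q ∧ StabLE co D q p := by
  have of_tr : ∀ {x y : CCSf Act}, (∀ μ s, Tr x μ s ↔ Tr y μ s) →
      StabLE co D x y ∧ StabLE co D y x :=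
    fun h => ⟨.of_tr h, .of_tr fun μ s => (h μ s).symm⟩
  have of_iff : ∀ {x y : CCSf Act}, (∀ r, Passes co D x r ↔ Passes co D y r) →
      (Unstable x ↔ Unstable y) → StabLE co D x y ∧ StabLE co D y x :=
    fun h h' => ⟨⟨fun r => (h r).1, h'.2⟩, ⟨fun r => (h r).2, h'.1⟩⟩
  cases h with
  | assoc x y z => exact of_tr (by simp [or_assoc])
  | comm x y => exact of_tr (by simp [or_comm])
  | unit x => exact of_tr (by simp)
  | idem x => exact of_tr (by simp)
  | s1a μ x y hx =>
    cases μ with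
    | tau => exact of_iff (fun r => passes_tau.symm) (by simp)
    | act a =>
      have ha : ∀ {x : CCSf Act}, ¬ Unstable (pre (.act a) x) := by simp [Unstable]
      refine of_iff (fun r => ⟨fun h => h.mono fun r hr h => ⟨?_, ?_, ?_⟩,
        fun h => h.mono fun r hr h => ⟨?_, ?_, ?_⟩⟩) (by simp [ha])
      · rcases h.progress hr with h1 | h1 | ⟨b, s, r', h1, h2⟩
        · simp [Unstable] at h1
        · exact Or.inr (Or.inl h1)
        · rw [tr_add, tr_pre, tr_pre, ← and_or_left] at h1
          exact Or.inr (Or.inr ⟨b, _, r', tr_pre.2 ⟨h1.1, rfl⟩, h2⟩)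
      · simp
      · simp only [tr_pre]
        rintro b q' r' ⟨⟨⟩, rfl⟩ h'
        exact passes_tau_add_tau.2
          ⟨h.synch (a := a) hr (by simp) h', h.synch (a := a) hr (by simp) h'⟩
      · rcases h.progress hr with h1 | h1 | ⟨b, s, r', h1, h2⟩
        · simp [Unstable] at h1
        · exact Or.inr (Or.inl h1)
        · exact Or.inr (Or.inr ⟨b, x, r', tr_add.2 (Or.inl (tr_pre.2 ⟨(tr_pre.1 h1).1, rfl⟩)), h2⟩)
      · simp
      · simp only [tr_pre, tr_add]
        rintro b q' r' (⟨⟨⟩, rfl⟩ | ⟨⟨⟩, rfl⟩) h'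
        · exact (passes_tau_add_tau.1 (h.synch (a := a) hr (tr_pre.2 ⟨rfl, rfl⟩) h')).1
        · exact (passes_tau_add_tau.1 (h.synch (a := a) hr (tr_pre.2 ⟨rfl, rfl⟩) h')).2
  | s2 x y hx =>
    exact of_iff (fun r => by rw [passes_tau_add_tau, passes_add_tau]) (by simp)
  | s3 μ x y z => exact of_iff (fun r => by rw [passes_tau, passes_s3]) (by simp)

theorem StdLE.stabLE (h : StdLE p q) : StabLE co D p q := by
  cases h with
  | s1b x => exact ⟨fun _ h => passes_tau.2 h, by simp⟩
  | s4 x y => exact ⟨fun _ h => (passes_tau_add_tau.1 h).1, by simp⟩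
  | s5 x => exact ⟨fun _ => Passes.of_tauInf, by simp [Unstable]⟩

theorem SVR.stabLE (h : SVR D p q) : StabLE co D p q := by
  cases h with
  | stdLE h => exact h.stabLE
  | stdEq h => exact h.stabLE.1
  | stdEq_symm h => exact h.stabLE.2
  | svr1 => exact .of_tr (by simp)
  | svr1_symm => exact .of_tr (by simp)

theorem Derivable.rel {E R : CCSf Act → CCSf Act → Prop} (hR : IsPrecongruence R)
    (hE : ∀ p q, E p q → R p q) (h : Derivable E p q) : R p q := by
  induction h with
  | ax h => exact hE _ _ h
  | refl p => exact hR.refl p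
  | trans _ _ h h' => exact hR.trans _ _ _ h h'
  | pre μ _ h => exact hR.pre μ _ _ h
  | add _ _ h h' => exact hR.add _ _ _ _ h h'

/-! ### `StabLE` coincides with the server precongruence. -/

theorem StabLE.svrPrecong (hco : Function.Injective co) (h : StabLE co D p q) :
    SvrPrecong co D p q :=
  ⟨StabLE co D, isPrecongruence_stabLE hco, fun _ _ h => svrLE_iff.2 h.passes, h⟩

theorem not_passes_of_notMem_acts (hco : Function.Injective co) {a : Act} (ha : a ∉ p.acts) :
    ¬ Passes co D p (CCS.pre (.act (co a)) CCS.one) := by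
  intro h
  generalize hr : (CCS.pre (.act (co a)) CCS.one : CCS Act (Option K)) = r at h
  induction h with
  | ok h => subst hr; simp at h
  | step hs _ _ _ ihl =>
    subst hr
    rcases hs with ⟨p', h⟩ | h | ⟨b, p', r', h1, h2⟩
    · exact ihl p' h (fun h' => ha (h.acts_subset h')) rfl
    · simp at h
    · obtain rfl : b = a := hco (by simp at h2; exact h2.1)
      exact ha h1.mem_acts

theorem SvrPrecong.stabLE [Infinite Act] (hco : Function.Injective co)
    (h : SvrPrecong co D p q) : StabLE co D p q := by
  obtain ⟨R, hR, hle, h⟩ := h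
  refine ⟨svrLE_iff.1 (hle _ _ h), fun ⟨q', hq'⟩ => ?_⟩
  by_contra hu
  -- With a fresh a, the client `a̅.1` finds no partner once q has moved to q', whereas the stable p
  -- keeps a.0 available.
  obtain ⟨a, ha⟩ := ((List.finite_toSet (p.acts ++ q.acts)).infinite_compl).nonempty
  simp only [Set.mem_compl_iff, Set.mem_ofPred_eq, List.mem_append, not_or] at ha
  have h1 : Passes co D (add p (pre (.act a) nil)) (CCS.pre (.act (co a)) CCS.one) := by
    refine .step (Or.inr (Or.inr ⟨a, nil, CCS.one, by simp, by simp⟩)) ?_ (by simp) ?_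
    · simp only [tr_add, tr_pre]
      rintro p' (h' | ⟨h', -⟩)
      · exact absurd ⟨p', h'⟩ hu
      · cases h'
    · intro b p' r' _ h'
      obtain ⟨-, rfl⟩ : co b = co a ∧ r' = CCS.one := by simpa using h'
      exact .ok happy_one
  have h2 := svrLE_iff.1 (hle _ _ (hR.add _ _ _ _ h (hR.refl (pre (.act a) nil)))) _ h1
  exact not_passes_of_notMem_acts hco (fun h' => ha.2 (hq'.acts_subset h'))
    (h2.left (p' := q') (by simp [hq']))

end Tests

/-! ### The algebra of finite terms modulo SVR -/

/-- Provable equality. -/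
def svrSetoid (D : K → CCS Act (Option K)) : Setoid (CCSf Act) where
  r p q := Derivable (SVR D) p q ∧ Derivable (SVR D) q p
  iseqv := ⟨fun p => ⟨.refl p, .refl p⟩, fun h => ⟨h.2, h.1⟩,
    fun h h' => ⟨h.1.trans h'.1, h'.2.trans h.2⟩⟩

/-- Finite terms modulo provable equality. -/
def Alg (D : K → CCS Act (Option K)) : Type u := Quotient (svrSetoid D)

namespace Alg

variable {D : K → CCS Act (Option K)}

/-- The class of a term. -/
def mk (D : K → CCS Act (Option K)) (p : CCSf Act) : Alg D := Quotient.mk (svrSetoid D) p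

instance : PartialOrder (Alg D) where
  le := Quotient.lift₂ (Derivable (SVR D)) fun _ _ _ _ h h' => propext
    ⟨fun h1 => h.2.trans (h1.trans h'.1), fun h1 => h.1.trans (h1.trans h'.2)⟩
  le_refl := by rintro ⟨p⟩; exact .refl p
  le_trans := by rintro ⟨p⟩ ⟨q⟩ ⟨r⟩ h h'; exact Derivable.trans h h'
  le_antisymm := by rintro ⟨p⟩ ⟨q⟩ h h'; exact Quotient.sound ⟨h, h'⟩

theorem mk_le_mk {p q : CCSf Act} : mk D p ≤ mk D q ↔ Derivable (SVR D) p q := Iff.rfl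

theorem mk_eq_of_stdEq {p q : CCSf Act} (h : StdEq D p q) : mk D p = mk D q :=
  Quotient.sound ⟨.ax (.stdEq h), .ax (.stdEq_symm h)⟩

/-- The operation of prefixing. -/
def pref (μ : ActTau Act) : Alg D → Alg D :=
  Quotient.map (CCSf.pre μ) fun _ _ h => ⟨.pre μ h.1, .pre μ h.2⟩

instance : Add (Alg D) :=
  ⟨Quotient.map₂ CCSf.add fun _ _ h _ _ h' => ⟨.add h.1 h'.1, .add h.2 h'.2⟩⟩

instance : Zero (Alg D) := ⟨mk D .nil⟩

@[simp] theorem mk_add (p q : CCSf Act) : mk D (.add p q) = mk D p + mk D q := rfl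

@[simp] theorem mk_pref (μ : ActTau Act) (p : CCSf Act) : mk D (.pre μ p) = pref μ (mk D p) := rfl

@[simp] theorem mk_nil : mk D (.nil : CCSf Act) = 0 := rfl

@[simp]
theorem mk_one : mk D (.one : CCSf Act) = 0 :=
  Quotient.sound ⟨.ax .svr1, .ax .svr1_symm⟩

instance : AddCommMonoid (Alg D) where
  add_assoc := by rintro ⟨x⟩ ⟨y⟩ ⟨z⟩; exact mk_eq_of_stdEq (.assoc x y z)
  add_comm := by rintro ⟨x⟩ ⟨y⟩; exact mk_eq_of_stdEq (.comm x y)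
  add_zero := by rintro ⟨x⟩; exact mk_eq_of_stdEq (.unit x)
  zero_add := by
    rintro ⟨x⟩
    exact (mk_eq_of_stdEq (.comm .nil x)).trans (mk_eq_of_stdEq (.unit x))
  nsmul := nsmulRec

@[simp]
theorem add_same (x : Alg D) : x + x = x := by
  induction x using Quotient.ind with
  | _ x => exact mk_eq_of_stdEq (.idem x)

theorem add_le_add' {x x' y y' : Alg D} (h : x ≤ x') (h' : y ≤ y') : x + y ≤ x' + y' := by
  induction x using Quotient.ind
  induction x' using Quotient.ind
  induction y using Quotient.ind
  induction y' using Quotient.ind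
  exact Derivable.add h h'

theorem pref_mono {x y : Alg D} (μ : ActTau Act) (h : x ≤ y) : pref μ x ≤ pref μ y := by
  induction x using Quotient.ind
  induction y using Quotient.ind
  exact Derivable.pre μ h

/-- Every element is represented by a term that cannot immediately report success. -/
theorem exists_notOk (x : Alg D) : ∃ p, NotOk D p ∧ mk D p = x := by
  induction x using Quotient.ind with
  | _ p =>
    change ∃ q, NotOk D q ∧ mk D q = mk D p
    induction p with
    | nil => exact ⟨.nil, by simp [NotOk, toCCS], rfl⟩
    -- SVR1 removes unguarded occurrences of 1, the only source of an immediate ✓; those under a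
    -- prefix may stay.
    | one => exact ⟨.nil, by simp [NotOk, toCCS], by simp⟩
    | add p q hp hq =>
      obtain ⟨p', hp, hp'⟩ := hp
      obtain ⟨q', hq, hq'⟩ := hq
      refine ⟨.add p' q', ?_, by simp [hp', hq']⟩
      rintro ⟨s, hs⟩
      rw [toCCS, CCS.step_add] at hs
      exact hs.elim (fun h => hp ⟨s, h⟩) (fun h => hq ⟨s, h⟩)
    | pre μ p => exact ⟨.pre μ p, by simp [NotOk, toCCS], rfl⟩
    | tauInf => exact ⟨.tauInf, by simp [NotOk, toCCS, CCS.defs], rfl⟩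

theorem s1a (μ : ActTau Act) (x y : Alg D) :
    pref μ x + pref μ y = pref μ (pref .tau x + pref .tau y) := by
  obtain ⟨x, hx, rfl⟩ := exists_notOk x
  obtain ⟨y, -, rfl⟩ := exists_notOk y
  exact mk_eq_of_stdEq (.s1a μ x y hx)

theorem s2 (x y : Alg D) : x + pref .tau y = pref .tau (x + y) + pref .tau y := by
  obtain ⟨x, hx, rfl⟩ := exists_notOk x
  obtain ⟨y, -, rfl⟩ := exists_notOk y
  exact mk_eq_of_stdEq (.s2 x y hx)

/-- S3 with y := x; idempotence then merges the two copies. -/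
theorem s3 (μ : ActTau Act) (x z : Alg D) :
    pref .tau (pref μ x + z) + pref μ x = pref .tau (pref μ x + z) := by
  obtain ⟨x, -, rfl⟩ := exists_notOk x
  obtain ⟨z, -, rfl⟩ := exists_notOk z
  have h := mk_eq_of_stdEq (.s3 (D := D) μ x x z)
  simpa [add_comm] using h

theorem tau_add_tau_le (x y : Alg D) : pref .tau x + pref .tau y ≤ x := by
  obtain ⟨x, -, rfl⟩ := exists_notOk x
  obtain ⟨y, -, rfl⟩ := exists_notOk y
  exact Derivable.ax (.stdLE (.s4 x y))

theorem tau_le (x : Alg D) : pref .tau x ≤ x := by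
  simpa using tau_add_tau_le x x

theorem tauInf_le (x : Alg D) : mk D .tauInf ≤ x := by
  obtain ⟨x, -, rfl⟩ := exists_notOk x
  exact Derivable.ax (.stdLE (.s5 x))

@[simp]
theorem tau_tauInf : pref .tau (mk D .tauInf) = mk D .tauInf :=
  le_antisymm (tau_le _) (tauInf_le _)

-- S2 writes x + τ^∞ as a sum of τ-prefixes including τ.τ^∞, which S4 bounds by τ^∞.
@[simp]
theorem add_tauInf (x : Alg D) : x + mk D .tauInf = mk D .tauInf := by
  refine le_antisymm ?_ (tauInf_le _)
  have h := s2 x (mk D .tauInf)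
  rw [tau_tauInf] at h
  rw [h, add_comm]
  nth_rewrite 1 [← tau_tauInf]
  exact tau_add_tau_le _ _

/-- S2 turns x into the internal choice τ.(x + y) + τ.y, and S1a for τ lets such a choice absorb a
leading τ. -/
theorem tau_of_absorb {x y : Alg D} (h : x + pref .tau y = x) : pref .tau x = x := by
  rw [s2] at h
  calc pref .tau x = pref .tau (pref .tau (x + y) + pref .tau y) := by rw [h]
    _ = x := by rw [← s1a, h]

/-- A sum absorbs the prefixes of its terms. -/
theorem mk_add_of_tr {p p' : CCSf Act} {μ : ActTau Act} (h : Tr p μ p') :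
    mk D p + pref μ (mk D p') = mk D p := by
  induction p with
  | nil => simp at h
  | one => simp at h
  | add p q hp hq =>
    rw [tr_add] at h
    rcases h with h | h
    · rw [mk_add, add_right_comm, hp h]
    · rw [mk_add, add_assoc, hq h]
  | pre ν p =>
    obtain ⟨rfl, rfl⟩ := tr_pre.1 h
    simp
  | tauInf =>
    obtain ⟨rfl, rfl⟩ := tr_tauInf.1 h
    simp

theorem mk_tau_of_unstable {p : CCSf Act} (h : Unstable p) : pref .tau (mk D p) = mk D p := by
  obtain ⟨p', h⟩ := h
  exact tau_of_absorb (mk_add_of_tr h)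

/-- S3 lets a summand under τ be absorbed outside it, one τ-move at a time. -/
theorem mk_add_of_tauStar_tr {p p' p'' : CCSf Act} {μ : ActTau Act} (h : TauStar p p')
    (h' : Tr p' μ p'') : mk D p + pref μ (mk D p'') = mk D p := by
  induction h using Relation.ReflTransGen.head_induction_on with
  | refl => exact mk_add_of_tr h'
  | @head p p₁ h1 _ ih =>
    rw [← mk_add_of_tr (D := D) h1, ← ih, add_comm (mk D p₁), add_assoc, s3]

/-- Divergence stems from a `tauInf` lying under sums and τ-prefixes only, and τ^∞ absorbs both. -/
theorem mk_of_not_conv {p : CCSf Act} (h : ¬ Conv p) : mk D p = mk D .tauInf := by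
  induction p with
  | nil => exact absurd ⟨by simp⟩ h
  | one => exact absurd ⟨by simp⟩ h
  | add p q hp hq =>
    by_cases h1 : Conv p
    · have h2 : ¬ Conv q := by
        refine fun h2 => h ⟨fun s hs => ?_⟩
        exact (tr_add.1 hs).elim h1.tr h2.tr
      simp [hq h2]
    · rw [mk_add, add_comm]
      simp [hp h1]
  | pre μ p ih =>
    cases μ with
    | act a => exact absurd ⟨by simp⟩ h
    | tau =>
      have : ¬ Conv p := fun h1 => h ⟨by simpa using h1⟩
      simp [ih this]
  | tauInf => rfl

/-- A term is the sum of its summands. -/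
theorem mk_eq_sum (p : CCSf Act) :
    mk D p = (p.summands.map fun s => pref s.1 (mk D s.2)).sum := by
  induction p with
  | nil => simp [summands]
  | one => simp [summands]
  | add p q hp hq => simp [summands, hp, hq]
  | pre μ p => simp [summands]
  | tauInf => simp [summands]

end Alg

open Alg

/-! ### Completeness -/

/-- The internal choice between the terms of a list. -/
def choice : List (CCSf Act) → CCSf Act
  | [] => nil
  | p :: l => add (pre .tau p) (choice l)

@[simp]
theorem tr_choice {l : List (CCSf Act)} {μ : ActTau Act} {s : CCSf Act} :
    Tr (choice l) μ s ↔ μ = .tau ∧ s ∈ l := by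
  induction l with
  | nil => simp [choice]
  | cons p l ih => simp [choice, ih, and_or_left]

/-- Prefixing a nonempty internal choice distributes. -/
theorem pref_choice {D : K → CCS Act (Option K)} (μ : ActTau Act) (p : CCSf Act)
    (l : List (CCSf Act)) :
    pref μ (mk D (choice (p :: l))) = ((p :: l).map fun q => pref μ (mk D q)).sum := by
  induction l generalizing p with
  | nil =>
    -- With equal arguments, S1a reads μ.x = μ.τ.x.
    have h := s1a μ (mk D p) (mk D p)
    simp only [add_same] at h
    simp [choice, ← h]
  | cons q l ih =>
    have hu : Unstable (choice (q :: l)) := ⟨q, by simp⟩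
    -- The unstable tail equals its own τ-prefix, so S1a applies to it.
    rw [show choice (p :: q :: l) = add (pre .tau p) (choice (q :: l)) from rfl, mk_add,
      mk_pref, ← mk_tau_of_unstable hu, ← s1a, ih]
    simp

theorem absorb_sum {M : Type*} [AddCommMonoid M] {x : M} {l : List M}
    (h : ∀ y ∈ l, x + y = x) : x + l.sum = x := by
  induction l with
  | nil => simp
  | cons y l ih =>
    rw [List.sum_cons, ← add_assoc, h y (by simp), ih fun z hz => h z (by simp [hz])]

theorem sum_absorb {D : K → CCS Act (Option K)} {l : List (Alg D)} {y : Alg D} (h : y ∈ l) :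
    l.sum + y = l.sum := by
  induction l with
  | nil => simp at h
  | cons z l ih =>
    rw [List.sum_cons]
    rcases List.mem_cons.1 h with rfl | h
    · rw [add_right_comm, add_same]
    · rw [add_assoc, ih h]

/-- A convergent term has finitely many weak derivatives. -/
theorem Conv.exists_list {p : CCSf Act} (hp : Conv p) (a : Act) :
    ∃ l : List (CCSf Act), ∀ p', p' ∈ l ↔ WTr p a p' := by
  induction hp with
  | @intro p hc ih =>
    have hf : {p' | WTr p a p'} = {p' | Tr p (.act a) p'} ∪
        ⋃ p₁ ∈ {p₁ | Tr p .tau p₁}, {p' | WTr p₁ a p'} := by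
      ext p'
      simp [wtr_iff (p := p)]
    have hT : ∀ μ, {p' | Tr p μ p'}.Finite := fun μ =>
      (List.finite_toSet p.summands).preimage (f := Prod.mk μ) (Prod.mk_right_injective μ).injOn
    have : {p' | WTr p a p'}.Finite := by
      rw [hf]
      refine (hT _).union ((hT _).biUnion fun p₁ hp₁ => ?_)
      obtain ⟨l, hl⟩ := ih p₁ hp₁
      exact (List.finite_toSet l).subset fun p' h => (hl p').2 h
    exact ⟨this.toFinset.toList, by simp⟩

/-- Only the loop of `tauInf` fails to decrease the size, and convergence excludes it. This is the
measure for completeness. -/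
theorem Tr.sizeOf_lt {p p' : CCSf Act} {μ : ActTau Act} (h : Tr p μ p') (hp : Conv p) :
    sizeOf p' < sizeOf p := by
  induction p with
  | nil => simp at h
  | one => simp at h
  | add p q ihp ihq =>
    rw [tr_add] at h
    have h1 : Conv p := ⟨fun s hs => hp.tr (by simp [hs])⟩
    have h2 : Conv q := ⟨fun s hs => hp.tr (by simp [hs])⟩
    rcases h with h | h
    · have := ihp h h1
      simp only [add.sizeOf_spec]
      omega
    · have := ihq h h2
      simp only [add.sizeOf_spec]
      omega
  | pre ν p =>
    obtain ⟨rfl, rfl⟩ := tr_pre.1 h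
    simp only [pre.sizeOf_spec]
    omega
  | tauInf =>
    exfalso
    clear h
    generalize hq : (tauInf : CCSf Act) = q at hp
    induction hp with
    | intro _ ih =>
      subst hq
      exact ih tauInf (by simp) rfl

section Completeness

variable {co : Act → Act} {D : K → CCS Act (Option K)} {p q : CCSf Act}

/-- A summand `μ.q'` of the larger term has a lower bound which is absorbed by the smaller
term `p` and absorbs the weak `μ`-derivatives of `p`. -/
theorem exists_lower_bound (hco : Function.Injective co) (hp : Conv p) (h : StabLE co D p q)
    {μ : ActTau Act} {q' : CCSf Act} (hq : Tr q μ q')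
    (ih : ∀ x : CCSf Act, StabLE co D x q' → mk D x ≤ mk D q') :
    ∃ y : Alg D, mk D p + y = mk D p ∧ y ≤ pref μ (mk D q') ∧
      (μ = .tau → y + mk D p = y) ∧
      ∀ a p', μ = .act a → WTr p a p' → y + pref (.act a) (mk D p') = y := by
  cases μ with
  | tau =>
    have hu : Unstable p := h.unstable ⟨q', hq⟩
    refine ⟨mk D p, by simp, ?_, by simp, by simp⟩
    rw [← mk_tau_of_unstable hu]
    exact pref_mono _ (ih p ⟨fun r hr => (h.passes r hr).left hq, fun _ => hu⟩)
  | act a =>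
    obtain ⟨l, hl⟩ := hp.exists_list a
    cases l with
    | nil =>
      -- Without weak a-derivatives of p, q' would have to pass the client 0.
      refine absurd (passes_of_wtr (t := CCS.nil) hco hp h.passes hq fun p' hp' => ?_)
        not_passes_nil
      simpa using (hl p').2 hp'
    | cons p₀ l =>
      -- A client passed by the choice is passed by each weak a-derivative; as the choice is
      -- unstable, the stability clause is free.
      have hle : StabLE co D (choice (p₀ :: l)) q' := by
        refine ⟨fun r hr => passes_of_wtr hco hp h.passes hq fun p' hp' => ?_,
          fun _ => ⟨p₀, by simp⟩⟩
        exact hr.left (tr_choice.2 ⟨rfl, (hl p').2 hp'⟩)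
      refine ⟨pref (.act a) (mk D (choice (p₀ :: l))), ?_, pref_mono _ (ih _ hle), by simp, ?_⟩
      · rw [pref_choice]
        refine absorb_sum fun y hy => ?_
        obtain ⟨p', hp', rfl⟩ := List.mem_map.1 hy
        obtain ⟨p₁, h1, h2⟩ := (hl p').1 hp'
        exact mk_add_of_tauStar_tr h1 h2
      · rintro b p' hb hp'
        cases hb
        rw [pref_choice]
        exact sum_absorb (List.mem_map_of_mem ((hl p').2 hp'))

theorem mk_le_mk_of_stabLE (hco : Function.Injective co) (h : StabLE co D p q) :
    mk D p ≤ mk D q := by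
  -- p is generalised because the internal choice of its derivatives need not be smaller.
  induction hn : sizeOf q using Nat.strong_induction_on generalizing p q with
  | _ n ih =>
  by_cases hp : Conv p
  swap
  · rw [mk_of_not_conv hp]
    exact tauInf_le _
  have hq : Conv q := hp.of_passes h.passes
  have hex : ∀ s : ActTau Act × CCSf Act, ∃ y : Alg D, s ∈ q.summands →
      mk D p + y = mk D p ∧ y ≤ pref s.1 (mk D s.2) ∧ (s.1 = .tau → y + mk D p = y) ∧
      ∀ a p', s.1 = .act a → WTr p a p' → y + pref (.act a) (mk D p') = y := by
    intro s
    by_cases hs : s ∈ q.summands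
    · obtain ⟨y, hy⟩ := exists_lower_bound hco hp h (μ := s.1) (q' := s.2) hs
        fun x hx => ih _ (hn ▸ Tr.sizeOf_lt hs hq) hx rfl
      exact ⟨y, fun _ => hy⟩
    · exact ⟨0, fun h => absurd h hs⟩
  choose f hf using hex
  set y := (q.summands.map f).sum with hy
  have hyq : y ≤ mk D q := by
    rw [mk_eq_sum, hy]
    have : ∀ l ⊆ q.summands, (l.map f).sum ≤ (l.map fun s => pref s.1 (mk D s.2)).sum := by
      intro l hl
      induction l with
      | nil => simp
      | cons s l ih =>
        simp only [List.map_cons, List.sum_cons]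
        exact add_le_add' (hf s (hl (by simp))).2.1 (ih fun t ht => hl (by simp [ht]))
    exact this _ (List.Subset.refl _)
  have hpy : mk D p + y = mk D p := by
    refine absorb_sum fun z hz => ?_
    obtain ⟨s, hs, rfl⟩ := List.mem_map.1 hz
    exact (hf s hs).1
  have hyf : ∀ s ∈ q.summands, ∀ z, f s + z = f s → y + z = y := by
    intro s hs z hz
    rw [hy, ← sum_absorb (List.mem_map_of_mem (f := f) hs), add_assoc, hz]
  refine le_trans ?_ hyq
  by_cases hu : Unstable q
  · obtain ⟨q', hq'⟩ := hu
    -- The bound of the τ-summand absorbs p, hence so does y.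
    rw [← hpy, add_comm, hyf _ hq' _ ((hf _ hq').2.2.1 rfl)]
  · obtain ⟨p', hpp', hp', hin⟩ := exists_stable hco hp h.passes hu
    have hyp' : y + mk D p' = y := by
      rw [mk_eq_sum]
      refine absorb_sum fun z hz => ?_
      obtain ⟨⟨μ, p''⟩, hs, rfl⟩ := List.mem_map.1 hz
      cases μ with
      | tau => exact absurd ⟨p'', hs⟩ hp'
      | act a =>
        obtain ⟨q', hq'⟩ := hin a p'' hs
        exact hyf _ hq' _ ((hf _ hq').2.2.2 a p'' rfl ⟨p', hpp', hs⟩)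
    rcases Relation.ReflTransGen.cases_tail hpp' with rfl | ⟨p₁, h1, h2⟩
    · rw [← hyp', add_comm, hpy]
    · have hpp : mk D p + pref .tau (mk D p') = mk D p := mk_add_of_tauStar_tr h1 h2
      -- S2 gives y + τ.p' = τ.y + τ.p', whose left side p absorbs.
      have h3 : mk D p + pref .tau y = mk D p := by
        have h4 := s2 y (mk D p')
        rw [hyp'] at h4
        calc mk D p + pref .tau y = mk D p + (y + pref .tau (mk D p')) + pref .tau y := by
              rw [← add_assoc, hpy, hpp]
          _ = mk D p := by
              rw [add_assoc, h4, add_right_comm, add_same, ← h4, ← add_assoc, hpy, hpp]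
      calc mk D p = pref .tau y + pref .tau (mk D p) := by
            rw [tau_of_absorb hpp, add_comm, h3]
        _ ≤ y := tau_add_tau_le _ _

end Completeness

end CCSf

end ServerTesting

theorem mainTheorem6 {Act : Type*} [Infinite Act] {K : Type*}
    (co : Act → Act) (hco : Function.Involutive co)
    (D : K → ServerTesting.CCS Act (Option K)) (p q : ServerTesting.CCSf Act) :
    ServerTesting.CCSf.SvrPrecong co D p q ↔
      ServerTesting.CCSf.Derivable (ServerTesting.CCSf.SVR D) p q := by
  refine ⟨fun h => ?_, fun h => ?_⟩
  · exact ServerTesting.CCSf.Alg.mk_le_mk.1 (ServerTesting.CCSf.mk_le_mk_of_stabLE hco.injective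
      (h.stabLE hco.injective))
  · exact (h.rel (ServerTesting.CCSf.isPrecongruence_stabLE hco.injective)
      fun _ _ h => h.stabLE).svrPrecong hco.injective
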